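/- Let $M$ be a smooth manifold, $A\to M$ a smooth real vector bundle of finite rank, and $(A,\phi_0,P,N)$ a Jacobi–Nijenhuis algebroid. This means the following. (i) $(A,[\cdot,\cdot],\rho)$ is a Lie algebroid with differential $\mathrm d$, and $\phi_0\in\Gamma(A^*)$ satisfies $\mathrm d\phi_0=0$. (ii) $P\in\Gamma(\wedge^2A)$ is a Jacobi bivector: $[P,P]^{\phi_0}:=[P,P]+2\,P\wedge i_{\phi_0}P=0$, where $[\cdot,\cdot]$ is the Schouten bracket, with the sign convention $[X_1\wedge X_2,Y_1\wedge Y_2]=\sum_{i,j}(-1)^{i+j}[X_i,Y_j]\wedge X_{3-i}\wedge Y_{3-j}$, and $i_{\phi_0}P=P(\phi_0,\cdot)$. Write $P^\sharp:A^*\to A$ for the map with $\langle\beta,P^\sharp\alpha\rangle=P(\alpha,\beta)$. (iii) $N:A\to A$ is a bundle map over the identity with $[NX,NY]=N[X,Y]_N$ for all sections $X,Y$ (a Nijenhuis operator), where $[X,Y]_N:=[NX,Y]+[X,NY]-N[X,Y]$. Put $A_N=(A,[\cdot,\cdot]_N,\rho\circ N)$. (iv) $N\circ P^\sharp=P^\sharp\circ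 N^*$, so that $NP$ is again a bivector, and the bracket $[\cdot,\cdot]_{NP}$ obtained from $(A,\phi_0)$ by $NP$ equals the bracket obtained from $(A_N,N^*\phi_0)$ by $P$. Here, for an algebroid $A$, a 1-form $\phi$ and a bivector $Q$ on $A$, the bracket on $\Gamma(A^*)$ obtained from $(A,\phi)$ by $Q$ is $$[\alpha,\beta]_Q=\mathcal L^{\phi}_{Q^\sharp\alpha}\beta-\mathcal L^{\phi}_{Q^\sharp\beta}\alpha-\mathrm d^{\phi}\big(Q(\alpha,\beta)\big),\qquad \mathrm d^{\phi}\omega=\mathrm d\omega+\phi\wedge\omega,\qquad \mathcal L^{\phi}_X\omega=i_X\mathrm d^{\phi}\omega+\mathrm d^{\phi}i_X\omega .$$ For a Jacobi bivector $Q$ on $(A,\phi_0)$ put $A^*_Q=(A^*,[\cdot,\cdot]_Q,\rho\circ Q^\sharp)$, the bracket being the one obtained from $(A,\phi_0)$. Then for every $k\in\mathbb N$ (including $k=0$): $A^*_P$ is a Lie algebroid and $N^{*k}$ is a Nijenhuis operator on it; the bivector $N^kP$, given by $(N^kP)^\sharp=N^k\circ P^\sharp$, is a Jacobi bivector on $(A,\phi_0)$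 and $A^*_{N^kP}$ is a Lie algebroid; and $A^*_{N^kP}$ coincides with the deformation of $A^*_P$ along $N^{*k}$, that is, for all $\alpha,\beta\in\Gamma(A^*)$, $$[\alpha,\beta]_{N^kP}=[N^{*k}\alpha,\beta]_P+[\alpha,N^{*k}\beta]_P-N^{*k}[\alpha,\beta]_P,\qquad \rho\circ N^k\circ P^\sharp=\rho\circ P^\sharp\circ N^{*k}.$$ -/

import Mathlib

open Bundle Manifold Topology
open scoped ContDiff

set_option linter.unusedSectionVars false

noncomputable section

namespace JNAlgebroid

section Bundles

variable {EM : Type*} [NormedAddCommGroup EM] [NormedSpace ℝ EM]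
  {H : Type*} [TopologicalSpace H] {I : ModelWithCorners ℝ EM H}
  {M : Type*} [TopologicalSpace M] [ChartedSpace H M]
  {F : Type*} [NormedAddCommGroup F] [NormedSpace ℝ F]
  {E : M → Type*} [∀ x, AddCommGroup (E x)] [∀ x, Module ℝ (E x)]
  [∀ x, TopologicalSpace (E x)] [TopologicalSpace (TotalSpace F E)]
  [FiberBundle F E] [VectorBundle ℝ F E]

lemma contMDiffAt_trivial_iff (g : M → ℝ) (x₀ : M) :
    ContMDiffAt I (I.prod 𝓘(ℝ, ℝ)) ∞
      (fun x => TotalSpace.mk' ℝ (E := Bundle.Trivial M ℝ) x (g x)) x₀ ↔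
    ContMDiffAt I 𝓘(ℝ, ℝ) ∞ g x₀ := by
  rw [contMDiffAt_section]
  rfl

/-- The product `f • σ` of a smooth function and a smooth section. -/
def fsmul (f : C^∞⟮I, M; 𝓘(ℝ, ℝ), ℝ⟯) (σ : Cₛ^∞⟮I; F, E⟯) : Cₛ^∞⟮I; F, E⟯ :=
  ⟨fun x => f x • σ x, f.contMDiff.smul_section σ.contMDiff⟩

@[simp] lemma fsmul_apply (f : C^∞⟮I, M; 𝓘(ℝ, ℝ), ℝ⟯) (σ : Cₛ^∞⟮I; F, E⟯) (x : M) :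
    fsmul f σ x = f x • σ x := rfl

section Ext
variable [FiniteDimensional ℝ EM] [T2Space M] [IsManifold I ∞ M]
  [ContMDiffVectorBundle ∞ F E I]

/-- A cut-off function near `x₀`, and the sections obtained by cutting off the constant sections
of the preferred trivialization at `x₀`. -/
lemma exists_cutoff (x₀ : M) : ∃ (f : C^∞⟮I, M; 𝓘(ℝ, ℝ), ℝ⟯) (S : F → Cₛ^∞⟮I; F, E⟯),
    (∀ᶠ x in 𝓝 x₀, f x = 1) ∧ tsupport f ⊆ (trivializationAt F E x₀).baseSet ∧
      ∀ v x, S v x = f x • (trivializationAt F E x₀).symm x v := by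
  obtain ⟨f, -, hf⟩ := ((SmoothBumpFunction.nhds_basis_tsupport (I := I) x₀).mem_iff).1
    ((trivializationAt F E x₀).open_baseSet.mem_nhds
      (FiberBundle.mem_baseSet_trivializationAt F E x₀))
  refine ⟨⟨f, f.contMDiff⟩, fun v => ⟨fun x => f x • (trivializationAt F E x₀).symm x v, ?_⟩,
    f.eventuallyEq_one, hf, fun v x => rfl⟩
  refine ContMDiffOn.smul_section_of_tsupport (s := fun x => (trivializationAt F E x₀).symm x v)
    f.contMDiff.contMDiffOn (trivializationAt F E x₀).open_baseSet hf ?_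
  rw [(trivializationAt F E x₀).contMDiffOn_section_baseSet_iff]
  apply (contMDiffOn_const (c := v)).congr
  intro y hy
  simp [hy]

/-- Every vector of the bundle is the value of a smooth section. -/
lemma exists_section_eq (x₀ : M) (v : E x₀) : ∃ σ : Cₛ^∞⟮I; F, E⟯, σ x₀ = v := by
  obtain ⟨f, S, hf, -, hS⟩ := exists_cutoff (I := I) (F := F) (E := E) x₀
  have hx := FiberBundle.mem_baseSet_trivializationAt F E x₀
  refine ⟨S ((trivializationAt F E x₀) ⟨x₀, v⟩).2, ?_⟩
  rw [hS, hf.self_of_nhds, one_smul]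
  exact (trivializationAt F E x₀).symm_proj_apply ⟨x₀, v⟩ hx

/-- A `C^∞(M)`-linear functional on sections is determined pointwise. -/
lemma functional_pointwise [FiniteDimensional ℝ F]
    (Φ : Cₛ^∞⟮I; F, E⟯ → C^∞⟮I, M; 𝓘(ℝ, ℝ), ℝ⟯)
    (hadd : ∀ σ τ, Φ (σ + τ) = Φ σ + Φ τ) (hsmul : ∀ f σ, Φ (fsmul f σ) = f * Φ σ)
    (σ τ : Cₛ^∞⟮I; F, E⟯) (x₀ : M) (h : σ x₀ = τ x₀) : Φ σ x₀ = Φ τ x₀ := by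
  let Ψ : Cₛ^∞⟮I; F, E⟯ →+ C^∞⟮I, M; 𝓘(ℝ, ℝ), ℝ⟯ := AddMonoidHom.mk' Φ hadd
  have key : ∀ σ : Cₛ^∞⟮I; F, E⟯, σ x₀ = 0 → Φ σ x₀ = 0 := by
    intro σ hσ
    obtain ⟨f, S, hf, hsup, hS⟩ := exists_cutoff (I := I) (F := F) (E := E) x₀
    have hx := FiberBundle.mem_baseSet_trivializationAt F E x₀
    set e := trivializationAt F E x₀ with he
    let b := Module.finBasis ℝ F
    have hc : ∀ i, ContMDiff I 𝓘(ℝ, ℝ) ∞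
        (fun x => f x * b.coord i (e ⟨x, σ x⟩).2) := by
      intro i x
      by_cases hxs : x ∈ tsupport f
      · have h1 := (e.contMDiffAt_section_iff (hsup hxs)).1 (σ.contMDiff x)
        have h2 : ContMDiffAt I 𝓘(ℝ, ℝ) ∞ (fun x => b.coord i (e ⟨x, σ x⟩).2) x :=
          ((b.coord i).toContinuousLinearMap.contMDiff _).comp x h1
        exact (f.contMDiff x).mul h2
      · have : (fun x => f x * b.coord i (e ⟨x, σ x⟩).2) =ᶠ[𝓝 x] fun _ => 0 := by
          filter_upwards [(isClosed_tsupport f).isOpen_compl.mem_nhds hxs] with y hy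
          rw [image_eq_zero_of_notMem_tsupport hy, zero_mul]
        exact contMDiffAt_const.congr_of_eventuallyEq this
    let c : Fin (Module.finrank ℝ F) → C^∞⟮I, M; 𝓘(ℝ, ℝ), ℝ⟯ := fun i => ⟨_, hc i⟩
    have hsum : fsmul (f * f) σ = ∑ i, fsmul (c i) (S (b i)) := by
      ext x
      have hcoe : (∑ i, fsmul (c i) (S (b i))) x = ∑ i, (fsmul (c i) (S (b i))) x := by
        have := map_sum (ContMDiffSection.coeAddHom I F ∞ E)
          (fun i => fsmul (c i) (S (b i))) Finset.univ
        have h' := congrFun this x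
        rw [Finset.sum_apply] at h'
        exact h'
      rw [hcoe]
      by_cases hxs : x ∈ tsupport f
      · have hxb := hsup hxs
        have hσx : σ x = e.symm x (e ⟨x, σ x⟩).2 := (e.symm_proj_apply ⟨x, σ x⟩ hxb).symm
        have hlin : e.symm x (e ⟨x, σ x⟩).2 =
            ∑ i, b.coord i (e ⟨x, σ x⟩).2 • e.symm x (b i) := by
          rw [← e.coe_symmₗ (R := ℝ) hxb]
          conv_lhs => rw [← b.sum_repr (e ⟨x, σ x⟩).2]
          have := map_sum (e.symmₗ ℝ x) (fun i => b.repr (e ⟨x, σ x⟩).2 i • b i) Finset.univ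
          exact this.trans (Finset.sum_congr rfl fun i _ => (e.symmₗ ℝ x).map_smul _ _)
        have : ((f * f) x) • σ x = (f x * f x) • ∑ i, b.coord i (e ⟨x, σ x⟩).2 • e.symm x (b i) := by
          rw [← hlin, ← hσx]; rfl
        rw [fsmul_apply, this, Finset.smul_sum]
        refine Finset.sum_congr rfl fun i _ => ?_
        rw [fsmul_apply, hS, smul_smul, smul_smul]
        congr 1
        change _ = (f x * b.coord i (e ⟨x, σ x⟩).2) * f x
        ring
      · have h0 : f x = 0 := image_eq_zero_of_notMem_tsupport hxs
        simp [hS, h0]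
    have h1 : Φ (fsmul (f * f) σ) x₀ = Φ σ x₀ := by
      rw [hsmul]
      change f x₀ * f x₀ * _ = _
      rw [hf.self_of_nhds]; ring
    rw [← h1, hsum]
    have h2 : Φ (∑ i, fsmul (c i) (S (b i))) = ∑ i, c i * Φ (S (b i)) := by
      have := map_sum Ψ (fun i => fsmul (c i) (S (b i))) Finset.univ
      refine this.trans (Finset.sum_congr rfl fun i _ => hsmul _ _)
    rw [h2]
    have h3 : ∀ i, c i x₀ = 0 := by
      intro i
      change f x₀ * b.coord i (e ⟨x₀, σ x₀⟩).2 = 0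
      have hz : (e ⟨x₀, σ x₀⟩).2 = 0 := by
        rw [hσ]; exact (e.linear ℝ hx).map_zero
      rw [hz]; simp
    have h4 := map_sum (ContMDiffMap.evalRingHom (I := I) (n := ∞) x₀) (fun i => c i * Φ (S (b i))) Finset.univ
    refine h4.trans (Finset.sum_eq_zero fun i _ => ?_)
    change c i x₀ * _ = 0
    rw [h3, zero_mul]
  have hsub : Φ (σ - τ) = Φ σ - Φ τ := map_sub Ψ σ τ
  have := key (σ - τ) (by simp [h])
  rw [hsub] at this
  exact sub_eq_zero.1 this

end Ext

variable {F' : Type*} [NormedAddCommGroup F'] [NormedSpace ℝ F']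
  {E' : M → Type*} [∀ x, AddCommGroup (E' x)] [∀ x, Module ℝ (E' x)]
  [∀ x, TopologicalSpace (E' x)] [TopologicalSpace (TotalSpace F' E')]
  [FiberBundle F' E'] [VectorBundle ℝ F' E']
  [∀ x, IsTopologicalAddGroup (E' x)] [∀ x, ContinuousSMul ℝ (E' x)]

/-- A family of linear maps between the fibres is a smooth section of the bundle of
homomorphisms as soon as it maps smooth sections to smooth sections. -/
lemma contMDiff_hom_of_apply [FiniteDimensional ℝ EM] [T2Space M] [IsManifold I ∞ M]
    [ContMDiffVectorBundle ∞ F E I] [ContMDiffVectorBundle ∞ F' E' I] [FiniteDimensional ℝ F]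
    (L : ∀ x, E x →L[ℝ] E' x)
    (hL : ∀ σ : Cₛ^∞⟮I; F, E⟯, ContMDiff I (I.prod 𝓘(ℝ, F')) ∞
      (fun x => TotalSpace.mk' F' x (L x (σ x)))) :
    ContMDiff I (I.prod 𝓘(ℝ, F →L[ℝ] F')) ∞
      (fun x => TotalSpace.mk' (F →L[ℝ] F') (E := fun x => E x →L[ℝ] E' x) x (L x)) := by
  intro x₀
  rw [contMDiffAt_hom_bundle]
  refine ⟨contMDiffAt_id, ?_⟩
  let A : M → F →L[ℝ] F' := fun x =>
    ContinuousLinearMap.inCoordinates F E F' E' x₀ x x₀ x (L x)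
  change ContMDiffAt I 𝓘(ℝ, F →L[ℝ] F') ∞ A x₀
  have hv : ∀ v, ContMDiffAt I 𝓘(ℝ, F') ∞ (fun x => A x v) x₀ := by
    intro v
    obtain ⟨f, S, hf, -, hS⟩ := exists_cutoff (I := I) (F := F) (E := E) x₀
    have hx := FiberBundle.mem_baseSet_trivializationAt F E x₀
    have hx' := FiberBundle.mem_baseSet_trivializationAt F' E' x₀
    have h1 := ((trivializationAt F' E' x₀).contMDiffAt_section_iff hx').1 (hL (S v) x₀)
    refine h1.congr_of_eventuallyEq ?_
    filter_upwards [hf, (trivializationAt F' E' x₀).open_baseSet.mem_nhds hx',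
      (trivializationAt F E x₀).open_baseSet.mem_nhds hx] with x h1x h2x h3x
    rw [hS, h1x, one_smul]
    simp only [A, ContinuousLinearMap.inCoordinates_eq h3x h2x]
    simp
  let b := Module.finBasis ℝ F
  have hA : A = fun x => ∑ i,
      ContinuousLinearMap.smulRightL ℝ F F' (b.coord i).toContinuousLinearMap (A x (b i)) := by
    funext x
    ext v
    have h := congrArg (A x) (b.sum_repr v)
    rw [map_sum] at h
    simpa using h.symm
  rw [hA]
  refine contMDiffAt_finsetSum fun i _ => ?_
  exact ((ContinuousLinearMap.smulRightL ℝ F F'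
    (b.coord i).toContinuousLinearMap).contMDiff _).comp x₀ (hv (b i))

/-- The value `L σ` of a homomorphism of vector bundles on a smooth section. -/
def app (L : Cₛ^∞⟮I; F →L[ℝ] F', fun x => E x →L[ℝ] E' x⟯)
    (σ : Cₛ^∞⟮I; F, E⟯) : Cₛ^∞⟮I; F', E'⟯ :=
  ⟨fun x => L x (σ x), ContMDiff.clm_bundle_apply L.contMDiff σ.contMDiff⟩

end Bundles

section Notions

variable {EM : Type*} [NormedAddCommGroup EM] [NormedSpace ℝ EM]
  {H : Type*} [TopologicalSpace H] (I : ModelWithCorners ℝ EM H)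
  {M : Type*} [TopologicalSpace M] [ChartedSpace H M]
  (F : Type*) [NormedAddCommGroup F] [NormedSpace ℝ F]
  (E : M → Type*) [∀ x, AddCommGroup (E x)] [∀ x, Module ℝ (E x)]
  [∀ x, TopologicalSpace (E x)] [TopologicalSpace (TotalSpace F E)]
  [FiberBundle F E] [VectorBundle ℝ F E]
  (F' : Type*) [NormedAddCommGroup F'] [NormedSpace ℝ F']
  (E' : M → Type*) [∀ x, AddCommGroup (E' x)] [∀ x, Module ℝ (E' x)]
  [∀ x, TopologicalSpace (E' x)] [TopologicalSpace (TotalSpace F' E')]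
  [FiberBundle F' E'] [VectorBundle ℝ F' E']
  [∀ x, IsTopologicalAddGroup (E' x)] [∀ x, ContinuousSMul ℝ (E' x)]

/-- The dual bundle `E*`; its model fibre is `F →L[ℝ] ℝ`. -/
abbrev DualBundle {M : Type*} [TopologicalSpace M] (E : M → Type*) [∀ x, AddCommGroup (E x)]
    [∀ x, Module ℝ (E x)] [∀ x, TopologicalSpace (E x)] (x : M) :=
  E x →L[ℝ] Bundle.Trivial M ℝ x

/-- Smooth homomorphisms of vector bundles `E → E'` over the identity of `M`. -/
abbrev BundleHom := Cₛ^∞⟮I; F →L[ℝ] F', fun x => E x →L[ℝ] E' x⟯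

/-- `A`-1-forms: smooth sections of the dual bundle `A*`. -/
abbrev OneForm := Cₛ^∞⟮I; F →L[ℝ] ℝ, DualBundle E⟯

variable {I F E F' E'}

/-- The function `⟨α, X⟩`. -/
def pairing (α : OneForm I F E) (X : Cₛ^∞⟮I; F, E⟯) : C^∞⟮I, M; 𝓘(ℝ, ℝ), ℝ⟯ :=
  ⟨fun x => α x (X x), fun x => (contMDiffAt_trivial_iff _ x).1 (app α X).contMDiff.contMDiffAt⟩

lemma pairing_apply (α : OneForm I F E) (X : Cₛ^∞⟮I; F, E⟯) (x : M) :
    pairing α X x = α x (X x) := rfl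

@[simp] lemma pairing_add_left (α β : OneForm I F E) (X : Cₛ^∞⟮I; F, E⟯) :
    pairing (α + β) X = pairing α X + pairing β X := rfl

@[simp] lemma pairing_sub_left (α β : OneForm I F E) (X : Cₛ^∞⟮I; F, E⟯) :
    pairing (α - β) X = pairing α X - pairing β X := rfl

@[simp] lemma pairing_neg_left (α : OneForm I F E) (X : Cₛ^∞⟮I; F, E⟯) :
    pairing (-α) X = -pairing α X := rfl

@[simp] lemma pairing_fsmul_left (f : C^∞⟮I, M; 𝓘(ℝ, ℝ), ℝ⟯) (α : OneForm I F E)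
    (X : Cₛ^∞⟮I; F, E⟯) : pairing (fsmul f α) X = f * pairing α X := rfl

@[simp] lemma pairing_add_right (α : OneForm I F E) (X Y : Cₛ^∞⟮I; F, E⟯) :
    pairing α (X + Y) = pairing α X + pairing α Y := by
  ext x; exact (α x).map_add _ _

@[simp] lemma pairing_sub_right (α : OneForm I F E) (X Y : Cₛ^∞⟮I; F, E⟯) :
    pairing α (X - Y) = pairing α X - pairing α Y := by
  ext x; exact (α x).map_sub _ _

@[simp] lemma pairing_neg_right (α : OneForm I F E) (X : Cₛ^∞⟮I; F, E⟯) :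
    pairing α (-X) = -pairing α X := by
  ext x; exact (α x).map_neg _

@[simp] lemma pairing_fsmul_right (α : OneForm I F E) (f : C^∞⟮I, M; 𝓘(ℝ, ℝ), ℝ⟯)
    (X : Cₛ^∞⟮I; F, E⟯) : pairing α (fsmul f X) = f * pairing α X := by
  ext x; exact (α x).map_smul _ _

@[simp] lemma app_add (L : BundleHom I F E F' E') (X Y : Cₛ^∞⟮I; F, E⟯) :
    app L (X + Y) = app L X + app L Y := by
  ext x; exact (L x).map_add _ _

@[simp] lemma app_fsmul (L : BundleHom I F E F' E') (f : C^∞⟮I, M; 𝓘(ℝ, ℝ), ℝ⟯)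
    (X : Cₛ^∞⟮I; F, E⟯) : app L (fsmul f X) = fsmul f (app L X) := by
  ext x; exact (L x).map_smul _ _

section Act
variable [IsManifold I ∞ M]

/-- The derivative `ρ(X) f` of a function along the image of a section under a bundle map
`ρ : E → TM`. -/
def act (ρ : BundleHom I F E EM (TangentSpace I (M := M))) (X : Cₛ^∞⟮I; F, E⟯)
    (f : C^∞⟮I, M; 𝓘(ℝ, ℝ), ℝ⟯) : C^∞⟮I, M; 𝓘(ℝ, ℝ), ℝ⟯ :=
  ⟨fun x => mvfderiv I f x (ρ x (X x)), by
    have h1 : ContMDiff I (I.prod 𝓘(ℝ, EM)) ∞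
        (fun x => TotalSpace.mk' EM (E := TangentSpace I (M := M)) x (ρ x (X x))) :=
      (app ρ X).contMDiff
    have h2 : ContMDiff I.tangent 𝓘(ℝ, ℝ).tangent ∞ (tangentMap I 𝓘(ℝ, ℝ) f) :=
      f.contMDiff.contMDiff_tangentMap (by simp)
    exact (contMDiff_snd_tangentBundle_modelSpace ℝ 𝓘(ℝ, ℝ)).comp (h2.comp h1)⟩

lemma act_apply (ρ : BundleHom I F E EM (TangentSpace I (M := M))) (X : Cₛ^∞⟮I; F, E⟯)
    (f : C^∞⟮I, M; 𝓘(ℝ, ℝ), ℝ⟯) (x : M) : act ρ X f x = mvfderiv I f x (ρ x (X x)) := rfl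

variable (ρ : BundleHom I F E EM (TangentSpace I (M := M)))

@[simp] lemma act_add_left (X Y : Cₛ^∞⟮I; F, E⟯) (f : C^∞⟮I, M; 𝓘(ℝ, ℝ), ℝ⟯) :
    act ρ (X + Y) f = act ρ X f + act ρ Y f := by
  ext x
  exact (congrArg (mvfderiv I f x) ((ρ x).map_add _ _)).trans ((mvfderiv I f x).map_add _ _)

@[simp] lemma act_fsmul_left (g : C^∞⟮I, M; 𝓘(ℝ, ℝ), ℝ⟯) (X : Cₛ^∞⟮I; F, E⟯)
    (f : C^∞⟮I, M; 𝓘(ℝ, ℝ), ℝ⟯) : act ρ (fsmul g X) f = g * act ρ X f := by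
  ext x
  exact (congrArg (mvfderiv I f x) ((ρ x).map_smul _ _)).trans ((mvfderiv I f x).map_smul _ _)

@[simp] lemma act_add_right (X : Cₛ^∞⟮I; F, E⟯) (f g : C^∞⟮I, M; 𝓘(ℝ, ℝ), ℝ⟯) :
    act ρ X (f + g) = act ρ X f + act ρ X g := by
  ext x
  have := mvfderiv_add (I := I) (f.mdifferentiableAt (x := x)) (g.mdifferentiableAt (x := x))
  exact congrArg (fun L => L (ρ x (X x))) this

@[simp] lemma act_mul_right (X : Cₛ^∞⟮I; F, E⟯) (f g : C^∞⟮I, M; 𝓘(ℝ, ℝ), ℝ⟯) :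
    act ρ X (f * g) = f * act ρ X g + g * act ρ X f := by
  ext x
  have := mvfderiv_mul (I := I) (f.mdifferentiableAt (x := x)) (g.mdifferentiableAt (x := x))
  exact congrArg (fun L => L (ρ x (X x))) this

@[simp] lemma act_neg_right (X : Cₛ^∞⟮I; F, E⟯) (f : C^∞⟮I, M; 𝓘(ℝ, ℝ), ℝ⟯) :
    act ρ X (-f) = -act ρ X f := by
  ext x
  have := mvfderiv_neg (I := I) (g := f) (x := x)
  exact congrArg (fun L => L (ρ x (X x))) this

@[simp] lemma act_sub_right (X : Cₛ^∞⟮I; F, E⟯) (f g : C^∞⟮I, M; 𝓘(ℝ, ℝ), ℝ⟯) :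
    act ρ X (f - g) = act ρ X f - act ρ X g := by
  rw [sub_eq_add_neg, act_add_right, act_neg_right, sub_eq_add_neg]

end Act

section Forms
variable [FiniteDimensional ℝ EM] [T2Space M] [IsManifold I ∞ M]
  [ContMDiffVectorBundle ∞ F E I]

lemma oneForm_ext {α β : OneForm I F E} (h : ∀ X, pairing α X = pairing β X) : α = β := by
  ext x v
  obtain ⟨X, rfl⟩ := exists_section_eq (I := I) (F := F) x v
  exact congrArg (fun f : C^∞⟮I, M; 𝓘(ℝ, ℝ), ℝ⟯ => f x) (h X)

variable [FiniteDimensional ℝ F] [∀ x, IsTopologicalAddGroup (E x)]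
  [∀ x, ContinuousSMul ℝ (E x)]

/-- The `A`-1-form given by a `C^∞(M)`-linear functional on the sections of `A`; it is
characterised by `pairing_mkForm`. -/
def mkForm (Φ : Cₛ^∞⟮I; F, E⟯ → C^∞⟮I, M; 𝓘(ℝ, ℝ), ℝ⟯)
    (hadd : ∀ σ τ, Φ (σ + τ) = Φ σ + Φ τ) (hsmul : ∀ f σ, Φ (fsmul f σ) = f * Φ σ) :
    OneForm I F E :=
  let s : ∀ x, E x → Cₛ^∞⟮I; F, E⟯ := fun x v => (exists_section_eq (I := I) (F := F) x v).choose
  have hs : ∀ x (v : E x), s x v x = v := fun x v =>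
    (exists_section_eq (I := I) (F := F) x v).choose_spec
  have hΦ := functional_pointwise Φ hadd hsmul
  have : ∀ x, T2Space (E x) := fun x => FiberBundle.t2Space F E x
  have : ∀ x, FiniteDimensional ℝ (E x) := fun x => VectorBundle.finiteDimensional ℝ F E x
  let L : ∀ x, E x →L[ℝ] Bundle.Trivial M ℝ x := fun x =>
    LinearMap.toContinuousLinearMap (E := E x) (F' := ℝ)
      { toFun := fun v => Φ (s x v) x
        map_add' := fun v w => by
          have := hΦ (s x (v + w)) (s x v + s x w) x (by simp [hs])
          rw [this, hadd]; rfl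
        map_smul' := fun c v => by
          have := hΦ (s x (c • v)) (fsmul (ContMDiffMap.const c) (s x v)) x
            (by simp [hs]; rfl)
          rw [this, hsmul]; rfl }
  ⟨L, contMDiff_hom_of_apply L fun σ x => (contMDiffAt_trivial_iff _ x).2 <| by
    have h : (fun x => L x (σ x)) = Φ σ := by
      funext y
      exact hΦ _ _ y (hs y _)
    exact h ▸ (Φ σ).contMDiff x⟩

@[simp] lemma pairing_mkForm (Φ : Cₛ^∞⟮I; F, E⟯ → C^∞⟮I, M; 𝓘(ℝ, ℝ), ℝ⟯)
    (hadd : ∀ σ τ, Φ (σ + τ) = Φ σ + Φ τ) (hsmul : ∀ f σ, Φ (fsmul f σ) = f * Φ σ)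
    (X : Cₛ^∞⟮I; F, E⟯) : pairing (mkForm Φ hadd hsmul) X = Φ X := by
  ext x
  exact functional_pointwise Φ hadd hsmul _ _ x
    (exists_section_eq (I := I) (F := F) x (X x)).choose_spec

end Forms
section HomOps
variable [FiniteDimensional ℝ EM] [T2Space M] [IsManifold I ∞ M]
  [ContMDiffVectorBundle ∞ F E I] [FiniteDimensional ℝ F] [∀ x, IsTopologicalAddGroup (E x)]
  [∀ x, ContinuousSMul ℝ (E x)]
  [ContMDiffVectorBundle ∞ F' E' I]
  {F'' : Type*} [NormedAddCommGroup F''] [NormedSpace ℝ F'']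
  {E'' : M → Type*} [∀ x, AddCommGroup (E'' x)] [∀ x, Module ℝ (E'' x)]
  [∀ x, TopologicalSpace (E'' x)] [TopologicalSpace (TotalSpace F'' E'')]
  [FiberBundle F'' E''] [VectorBundle ℝ F'' E'']
  [∀ x, IsTopologicalAddGroup (E'' x)] [∀ x, ContinuousSMul ℝ (E'' x)]
  [ContMDiffVectorBundle ∞ F'' E'' I]

/-- The fibrewise composition `K ∘ L` of bundle homomorphisms. -/
def homComp (K : BundleHom I F' E' F'' E'') (L : BundleHom I F E F' E') :
    BundleHom I F E F'' E'' :=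
  ⟨fun x => (K x).comp (L x), contMDiff_hom_of_apply _ fun σ => (app K (app L σ)).contMDiff⟩

/-- The fibrewise power `N^k` of a bundle endomorphism, with `N^0 = id`. -/
def homPow (N : BundleHom I F E F E) (k : ℕ) : BundleHom I F E F E :=
  ⟨fun x => N x ^ k, contMDiff_hom_of_apply _ fun σ => by
    induction k generalizing σ with
    | zero => exact σ.contMDiff
    | succ k ih =>
      have := ih (app N σ)
      simp only [pow_succ]
      exact this⟩

/-- The transpose `N* : A* → A*`, `N* α = α ∘ N`, of a bundle endomorphism `N` of `A`. -/
def transpose (N : BundleHom I F E F E) :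
    BundleHom I (F →L[ℝ] ℝ) (DualBundle E) (F →L[ℝ] ℝ) (DualBundle E) :=
  ⟨fun x => ContinuousLinearMap.precomp (Bundle.Trivial M ℝ x) (N x),
    contMDiff_hom_of_apply _ fun α => contMDiff_hom_of_apply _ fun σ =>
      (app α (app N σ)).contMDiff⟩

@[simp] lemma pairing_transpose (N : BundleHom I F E F E) (α : OneForm I F E)
    (X : Cₛ^∞⟮I; F, E⟯) : pairing (app (transpose N) α) X = pairing α (app N X) := rfl

@[simp] lemma act_homComp (ρ : BundleHom I F' E' EM (TangentSpace I (M := M)))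
    (L : BundleHom I F E F' E') (X : Cₛ^∞⟮I; F, E⟯) (f : C^∞⟮I, M; 𝓘(ℝ, ℝ), ℝ⟯) :
    act (homComp ρ L) X f = act ρ (app L X) f := rfl

end HomOps

section Algebroid
variable [FiniteDimensional ℝ EM] [T2Space M] [IsManifold I ∞ M]
  [ContMDiffVectorBundle ∞ F E I] [FiniteDimensional ℝ F] [∀ x, IsTopologicalAddGroup (E x)]
  [∀ x, ContinuousSMul ℝ (E x)]

variable (I F E) in
/-- An anchored bracket on the vector bundle `E → M`: an `ℝ`-bilinear skew-symmetric bracket on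
the smooth sections together with a bundle map `ρ : E → TM` (the anchor) satisfying the Leibniz
rule `[X, f Y] = f [X, Y] + (ρ(X) f) Y`. It is a Lie algebroid when `IsLieAlgebroid` holds. -/
@[ext] structure SkewAlgebroid where
  bracket : Cₛ^∞⟮I; F, E⟯ → Cₛ^∞⟮I; F, E⟯ → Cₛ^∞⟮I; F, E⟯
  anchor : BundleHom I F E EM (TangentSpace I (M := M))
  bracket_add_left : ∀ X Y Z, bracket (X + Y) Z = bracket X Z + bracket Y Z
  bracket_smul_left : ∀ (c : ℝ) X Y, bracket (c • X) Y = c • bracket X Y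
  bracket_skew : ∀ X Y, bracket X Y = -bracket Y X
  leibniz : ∀ X f Y, bracket X (fsmul f Y) = fsmul f (bracket X Y) + fsmul (act anchor X f) Y

namespace SkewAlgebroid

variable (A : SkewAlgebroid I F E)

lemma bracket_add_right (X Y Z : Cₛ^∞⟮I; F, E⟯) :
    A.bracket X (Y + Z) = A.bracket X Y + A.bracket X Z := by
  rw [A.bracket_skew, A.bracket_add_left, A.bracket_skew Y, A.bracket_skew Z]; abel

lemma leibniz_left (f : C^∞⟮I, M; 𝓘(ℝ, ℝ), ℝ⟯) (X Y : Cₛ^∞⟮I; F, E⟯) :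
    A.bracket (fsmul f X) Y = fsmul f (A.bracket X Y) - fsmul (act A.anchor Y f) X := by
  rw [A.bracket_skew, A.leibniz, A.bracket_skew Y X]
  ext x
  simp; abel

/-- A Lie algebroid: the bracket satisfies the Jacobi identity, and the anchor is a morphism of
Lie algebras to the vector fields of `M` (acting as derivations of `C^∞(M)`). -/
structure IsLieAlgebroid : Prop where
  jacobi : ∀ X Y Z, A.bracket X (A.bracket Y Z) + A.bracket Y (A.bracket Z X) +
    A.bracket Z (A.bracket X Y) = 0
  anchor_bracket : ∀ X Y f, act A.anchor (A.bracket X Y) f =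
    act A.anchor X (act A.anchor Y f) - act A.anchor Y (act A.anchor X f)

/-- The bracket `[X, Y]_N = [N X, Y] + [X, N Y] - N [X, Y]`. -/
def deformedBracket (N : BundleHom I F E F E) (X Y : Cₛ^∞⟮I; F, E⟯) : Cₛ^∞⟮I; F, E⟯ :=
  A.bracket (app N X) Y + A.bracket X (app N Y) - app N (A.bracket X Y)

/-- The deformation `A_N = (A, [ , ]_N, ρ ∘ N)` of `A` along a bundle map `N : A → A`. -/
def deform (N : BundleHom I F E F E) : SkewAlgebroid I F E where
  bracket := A.deformedBracket N
  anchor := homComp A.anchor N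
  bracket_add_left X Y Z := by
    simp only [deformedBracket, app_add, A.bracket_add_left]; abel
  bracket_smul_left c X Y := by
    have h : ∀ Z, app N (c • Z) = c • app N Z := fun Z => by ext x; exact (N x).map_smul _ _
    simp only [deformedBracket, h, A.bracket_smul_left, smul_sub, smul_add]
  bracket_skew X Y := by
    have h : ∀ Z, app N (-Z) = -app N Z := fun Z => by ext x; exact (N x).map_neg _
    simp only [deformedBracket]
    rw [A.bracket_skew (app N X), A.bracket_skew X (app N Y), A.bracket_skew X Y, h]; abel
  leibniz X f Y := by
    simp only [deformedBracket, app_fsmul, A.leibniz, app_add, act_homComp]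
    ext x
    simp only [ContMDiffSection.coe_add, ContMDiffSection.coe_sub, Pi.add_apply, Pi.sub_apply,
      fsmul_apply, smul_add, smul_sub]
    abel

/-- `N` is a Nijenhuis operator on `A`: its torsion `T_N(X, Y) = [N X, N Y] - N [X, Y]_N`
vanishes. -/
def IsNijenhuis (N : BundleHom I F E F E) : Prop :=
  ∀ X Y, A.bracket (app N X) (app N Y) - app N (A.deformedBracket N X Y) = 0

/-- The Lie algebroid differential of a function: `⟨d f, X⟩ = ρ(X) f`. -/
def dFun (f : C^∞⟮I, M; 𝓘(ℝ, ℝ), ℝ⟯) : OneForm I F E :=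
  mkForm (fun X => act A.anchor X f) (by simp) (by simp)

/-- The Lie algebroid differential of a 1-form:
`d η (X, Y) = ρ(X) ⟨η, Y⟩ - ρ(Y) ⟨η, X⟩ - ⟨η, [X, Y]⟩`. -/
def dForm (η : OneForm I F E) (X Y : Cₛ^∞⟮I; F, E⟯) : C^∞⟮I, M; 𝓘(ℝ, ℝ), ℝ⟯ :=
  act A.anchor X (pairing η Y) - act A.anchor Y (pairing η X) - pairing η (A.bracket X Y)

/-- `φ` is a 1-cocycle of `A`, that is, `d φ = 0`. When `A` is a Lie algebroid, `(A, φ)` is then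
a Jacobi algebroid. -/
def IsCocycle (φ : OneForm I F E) : Prop := ∀ X Y, A.dForm φ X Y = 0

/-- The `φ`-differential of a function: `d^φ f = d f + f φ`. -/
def phiDFun (φ : OneForm I F E) (f : C^∞⟮I, M; 𝓘(ℝ, ℝ), ℝ⟯) : OneForm I F E :=
  A.dFun f + fsmul f φ

/-- The `φ`-differential of a 1-form: `d^φ η = d η + φ ∧ η`. -/
def phiDForm (φ η : OneForm I F E) (X Y : Cₛ^∞⟮I; F, E⟯) : C^∞⟮I, M; 𝓘(ℝ, ℝ), ℝ⟯ :=
  A.dForm η X Y + (pairing φ X * pairing η Y - pairing φ Y * pairing η X)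

/-- The `φ`-Lie derivative of a 1-form: `L^φ_X η = i_X d^φ η + d^φ (i_X η)`. -/
def phiLie (φ : OneForm I F E) (X : Cₛ^∞⟮I; F, E⟯) (η : OneForm I F E) : OneForm I F E :=
  mkForm (fun Y => A.phiDForm φ η X Y)
    (fun Y Z => by simp [phiDForm, dForm, A.bracket_add_right]; ring)
    (fun f Y => by simp [phiDForm, dForm, A.leibniz]; ring) +
  A.phiDFun φ (pairing η X)

/-- The bracket on the sections of `A*` induced by a bundle map `P♯ : A* → A`, where
`P(α, β) = ⟨β, P♯ α⟩`:
`[α, β]_P = L^φ_{P♯α} β - L^φ_{P♯β} α - d^φ (P(α, β))`. -/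
def dualBracket (φ : OneForm I F E) (P : BundleHom I (F →L[ℝ] ℝ) (DualBundle E) F E)
    (α β : OneForm I F E) : OneForm I F E :=
  A.phiLie φ (app P α) β - A.phiLie φ (app P β) α - A.phiDFun φ (pairing β (app P α))

lemma pairing_dualBracket (φ : OneForm I F E)
    (P : BundleHom I (F →L[ℝ] ℝ) (DualBundle E) F E) (α β : OneForm I F E)
    (Y : Cₛ^∞⟮I; F, E⟯) : pairing (A.dualBracket φ P α β) Y =
      (A.phiDForm φ β (app P α) Y + pairing (A.phiDFun φ (pairing β (app P α))) Y) -
      (A.phiDForm φ α (app P β) Y + pairing (A.phiDFun φ (pairing α (app P β))) Y) -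
      pairing (A.phiDFun φ (pairing β (app P α))) Y := by
  simp [dualBracket, phiLie]

end SkewAlgebroid

variable (I F E) in
/-- An `A`-bivector field `P`, given by the skew-symmetric bundle map `P♯ : A* → A` with
`P(α, β) = ⟨β, P♯ α⟩`. -/
structure Bivector where
  sharp : BundleHom I (F →L[ℝ] ℝ) (DualBundle E) F E
  skew : ∀ (x : M) (α β : DualBundle E x), β (sharp x α) = -α (sharp x β)

namespace Bivector

/-- The function `P(α, β)`. -/
def eval (P : Bivector I F E) (α β : OneForm I F E) : C^∞⟮I, M; 𝓘(ℝ, ℝ), ℝ⟯ :=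
  pairing β (app P.sharp α)

lemma eval_skew (P : Bivector I F E) (α β : OneForm I F E) :
    pairing β (app P.sharp α) = -pairing α (app P.sharp β) := by
  ext x; exact P.skew x (α x) (β x)

end Bivector

namespace SkewAlgebroid

variable (A : SkewAlgebroid I F E)

/-- The structure `A*_P = (A*, [ , ]_P, ρ ∘ P♯)` induced on the dual bundle by a bivector `P`. -/
def dual (φ : OneForm I F E) (P : Bivector I F E) :
    SkewAlgebroid I (F →L[ℝ] ℝ) (DualBundle E) where
  bracket := A.dualBracket φ P.sharp
  anchor := homComp A.anchor P.sharp
  bracket_add_left α β γ := oneForm_ext fun Y => by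
    simp [pairing_dualBracket, phiDForm, phiDFun, dForm, dFun, A.bracket_add_left]
    ring
  bracket_smul_left c α β := by
    have h : ∀ γ : OneForm I F E, c • γ = fsmul (ContMDiffMap.const c) γ := fun γ => by ext; rfl
    have hc : ∀ X, act A.anchor X (ContMDiffMap.const c) = 0 := fun X => by
      ext x
      exact congrArg (fun L => L (A.anchor x (X x))) (mvfderiv_const (I := I) (x := x) c)
    rw [h, h]
    refine oneForm_ext fun Y => ?_
    simp [pairing_dualBracket, phiDForm, phiDFun, dForm, dFun, A.leibniz_left, hc]
    ring
  bracket_skew α β := oneForm_ext fun Y => by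
    have := P.eval_skew α β
    simp [pairing_dualBracket, phiDForm, phiDFun, dForm, dFun, this]
    ring
  leibniz α f β := oneForm_ext fun Y => by
    have := P.eval_skew α β
    simp [pairing_dualBracket, phiDForm, phiDFun, dForm, dFun, A.leibniz_left, this]
    ring

end SkewAlgebroid
/-- The value on three 1-forms of the decomposable trivector `X ∧ Y ∧ Z`. -/
def wedge₃ (X Y Z : Cₛ^∞⟮I; F, E⟯) (α β γ : OneForm I F E) : C^∞⟮I, M; 𝓘(ℝ, ℝ), ℝ⟯ :=
  pairing α X * (pairing β Y * pairing γ Z - pairing β Z * pairing γ Y) +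
  pairing β X * (pairing γ Y * pairing α Z - pairing γ Z * pairing α Y) +
  pairing γ X * (pairing α Y * pairing β Z - pairing α Z * pairing β Y)

namespace Bivector

/-- The interior product `i_φ P = P(φ, ·)` of a bivector with a 1-form. -/
def interior (φ : OneForm I F E) (P : Bivector I F E) : Cₛ^∞⟮I; F, E⟯ := app P.sharp φ

/-- The value on three 1-forms of the trivector `P ∧ X`. -/
def wedge (P : Bivector I F E) (X : Cₛ^∞⟮I; F, E⟯) (α β γ : OneForm I F E) :
    C^∞⟮I, M; 𝓘(ℝ, ℝ), ℝ⟯ :=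
  P.eval α β * pairing γ X + P.eval β γ * pairing α X + P.eval γ α * pairing β X

/-- If `N P♯ = P♯ N*`, then `N^k P♯` is again skew-symmetric: the bivector `N^k P`. -/
def powComp (P : Bivector I F E) (N : BundleHom I F E F E)
    (h : homComp N P.sharp = homComp P.sharp (transpose N)) (k : ℕ) : Bivector I F E where
  sharp := homComp (homPow N k) P.sharp
  skew x α β := by
    have h1 : ∀ (x : M) (δ : DualBundle E x),
        N x (P.sharp x δ) = P.sharp x (δ.comp (N x)) := fun x δ =>
      congrArg (fun L : BundleHom I (F →L[ℝ] ℝ) (DualBundle E) F E => L x δ) h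
    have h2 : ∀ (k : ℕ) (δ : DualBundle E x),
        (N x ^ k) (P.sharp x δ) = P.sharp x (δ.comp (N x ^ k)) := by
      intro k
      induction k with
      | zero => intro δ; rfl
      | succ k ih =>
        intro δ
        have h3 : (N x ^ (k + 1)) (P.sharp x δ) = (N x ^ k) (N x (P.sharp x δ)) := by
          rw [pow_succ]; rfl
        rw [h3, h1, ih, pow_succ']
        rfl
    have h4 := P.skew x α (β.comp (N x ^ k))
    rw [← h2] at h4
    exact h4

end Bivector

namespace SkewAlgebroid

variable (A : SkewAlgebroid I F E)

/-- The Schouten bracket `[P, Q]` of two bivectors, evaluated on three 1-forms. That this is the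
Schouten bracket is the content of `schouten_of_decomposable`. -/
def schouten (P Q : Bivector I F E) (α β γ : OneForm I F E) : C^∞⟮I, M; 𝓘(ℝ, ℝ), ℝ⟯ :=
  let T : OneForm I F E → OneForm I F E → OneForm I F E → C^∞⟮I, M; 𝓘(ℝ, ℝ), ℝ⟯ := fun α β γ =>
    pairing α (A.bracket (app P.sharp β) (app Q.sharp γ)) +
    pairing α (A.bracket (app Q.sharp β) (app P.sharp γ)) -
    act A.anchor (app P.sharp α) (Q.eval β γ) - act A.anchor (app Q.sharp α) (P.eval β γ)
  T α β γ + T β γ α + T γ α β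

lemma bracket_sub_left (X Y Z : Cₛ^∞⟮I; F, E⟯) :
    A.bracket (X - Y) Z = A.bracket X Z - A.bracket Y Z := by
  have h := A.bracket_add_left (X - Y) Y Z
  rw [sub_add_cancel] at h
  rw [h]; abel

lemma bracket_sub_right (X Y Z : Cₛ^∞⟮I; F, E⟯) :
    A.bracket X (Y - Z) = A.bracket X Y - A.bracket X Z := by
  rw [A.bracket_skew, A.bracket_sub_left, A.bracket_skew Y, A.bracket_skew Z]; abel

/-- The bracket `schouten` is given on decomposable bivectors by
`[X₁ ∧ X₂, Y₁ ∧ Y₂] = ∑ i j, (-1)^(i + j) [X_i, Y_j] ∧ X_{i'} ∧ Y_{j'}`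
where `{i, i'} = {j, j'} = {1, 2}`. -/
lemma schouten_of_decomposable (P Q : Bivector I F E) (X₁ X₂ Y₁ Y₂ : Cₛ^∞⟮I; F, E⟯)
    (hP : ∀ α, app P.sharp α = fsmul (pairing α X₁) X₂ - fsmul (pairing α X₂) X₁)
    (hQ : ∀ α, app Q.sharp α = fsmul (pairing α Y₁) Y₂ - fsmul (pairing α Y₂) Y₁)
    (α β γ : OneForm I F E) :
    A.schouten P Q α β γ =
      wedge₃ (A.bracket X₁ Y₁) X₂ Y₂ α β γ - wedge₃ (A.bracket X₁ Y₂) X₂ Y₁ α β γ -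
      wedge₃ (A.bracket X₂ Y₁) X₁ Y₂ α β γ + wedge₃ (A.bracket X₂ Y₂) X₁ Y₁ α β γ := by
  have hs : ∀ X Y f, act A.anchor (X - Y) f = act A.anchor X f - act A.anchor Y f := by
    intro X Y f
    have h := act_add_left A.anchor (X - Y) Y f
    rw [sub_add_cancel] at h
    rw [h]; ring
  simp only [schouten, wedge₃, Bivector.eval, hP, hQ, A.bracket_sub_left, A.bracket_sub_right,
    A.leibniz, A.leibniz_left, pairing_add_right, pairing_sub_right, pairing_fsmul_right, hs,
    act_fsmul_left, act_sub_right, act_mul_right, A.bracket_skew Y₁ X₁, A.bracket_skew Y₁ X₂,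
    A.bracket_skew Y₂ X₁, A.bracket_skew Y₂ X₂, pairing_neg_right]
  ring

/-- The Schouten-Jacobi bracket of two bivectors, evaluated on three 1-forms:
`[P, Q]^φ = [P, Q] + P ∧ i_φ Q + i_φ P ∧ Q`, which is
`[P, Q] + (p - 1) P ∧ i_φ Q - (-1)^(p - 1) (q - 1) i_φ P ∧ Q` for `p = q = 2`. -/
def schoutenJacobi (φ : OneForm I F E) (P Q : Bivector I F E) (α β γ : OneForm I F E) :
    C^∞⟮I, M; 𝓘(ℝ, ℝ), ℝ⟯ :=
  A.schouten P Q α β γ + P.wedge (Q.interior φ) α β γ + Q.wedge (P.interior φ) α β γ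

/-- `P` is a Jacobi bivector on `(A, φ)`: `[P, P]^φ = 0`. -/
def IsJacobiBivector (φ : OneForm I F E) (P : Bivector I F E) : Prop :=
  ∀ α β γ, A.schoutenJacobi φ P P α β γ = 0

/-- `(A, φ₀, P, N)` is a Jacobi-Nijenhuis algebroid: `(A, φ₀)` is a Jacobi algebroid, `P` is a
Jacobi bivector on it, `N` is a Nijenhuis operator on `A`, and `P` and `N` are compatible, that
is, `N P = P N*` and the bracket on `A*` obtained from `(A, φ₀)` by `N P` coincides with the
bracket on `A*` obtained from `(A_N, N* φ₀)` by `P`. -/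
structure IsJacobiNijenhuis (φ₀ : OneForm I F E) (P : Bivector I F E)
    (N : BundleHom I F E F E) : Prop where
  isLie : A.IsLieAlgebroid
  cocycle : A.IsCocycle φ₀
  jacobi : A.IsJacobiBivector φ₀ P
  nijenhuis : A.IsNijenhuis N
  comm : homComp N P.sharp = homComp P.sharp (transpose N)
  bracket_eq : ∀ α β, A.dualBracket φ₀ (homComp N P.sharp) α β =
    (A.deform N).dualBracket (app (transpose N) φ₀) P.sharp α β

end SkewAlgebroid
end Algebroid
end Notions
end JNAlgebroid

end

/-!
The cocycle `φ₀` is absorbed into the twisted action `X · f = ρ(X) f + ⟨φ₀, X⟩ f` of sections on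
functions. With it, `⟨L^φ_X η, Y⟩ = X · ⟨η, Y⟩ - ⟨η, [X, Y]⟩`, so the bracket induced by a bivector
is given by the formula of the Poisson case (`pairing_dualBracket_phiAct`), and the action is flat
on a Jacobi algebroid (`phiAct_bracket`). As for Poisson structures, `[P, P]^φ = 0` means that `P♯`
preserves brackets (`isJacobiBivector_iff`), and then `A*_P` is a Lie algebroid
(`IsJacobiBivector.isLieAlgebroid_dual`).

For a Jacobi-Nijenhuis structure, let `C(α, β)` be the difference of the brackets induced by `N P`
on `(A, φ₀)` and by `P` on `(A_N, N* φ₀)`, so that `C = 0`. Three identities carry the proof.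
* The deformation of `[ , ]_P` along `N*` equals `[ , ]_{NP} + C`, hence `[ , ]_{NP}`. As `P♯`
  preserves brackets and `N` is Nijenhuis, `N P♯` then preserves brackets too, so `N P` is Jacobi.
* With `[ , ]_{NP}` as the deformed bracket, the torsion of `N*` on `A*_P` at `(α, β)` is
  `C(α, N* β)`, hence zero.
* `⟨C_{k+1}(α, β), Y⟩ = ⟨C_1(α, N*^k β), Y⟩ + ⟨C_k(α, β), N Y⟩`, where `C_k` belongs to `N^k`. Since
  powers of a Nijenhuis operator are Nijenhuis, `(A, φ₀, P, N^k)` is again a Jacobi-Nijenhuis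
  structure (`IsJacobiNijenhuis.homPow`), and the first two identities apply to `N^k`.
-/

noncomputable section

namespace JNAlgebroid

section TwistedAction

variable {EM : Type*} [NormedAddCommGroup EM] [NormedSpace ℝ EM] [FiniteDimensional ℝ EM]
  {H : Type*} [TopologicalSpace H] {I : ModelWithCorners ℝ EM H}
  {M : Type*} [TopologicalSpace M] [T2Space M] [ChartedSpace H M] [IsManifold I ∞ M]
  {F : Type*} [NormedAddCommGroup F] [NormedSpace ℝ F] [FiniteDimensional ℝ F]
  {E : M → Type*} [∀ x, AddCommGroup (E x)] [∀ x, Module ℝ (E x)]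
  [∀ x, TopologicalSpace (E x)] [∀ x, IsTopologicalAddGroup (E x)]
  [∀ x, ContinuousSMul ℝ (E x)] [TopologicalSpace (TotalSpace F E)]
  [FiberBundle F E] [VectorBundle ℝ F E] [ContMDiffVectorBundle ∞ F E I]

/-! ### Bundle endomorphisms and separation of sections by 1-forms -/

/-- Sections are separated by 1-forms. -/
lemma section_ext_of_pairing {X Y : Cₛ^∞⟮I; F, E⟯} (h : ∀ α : OneForm I F E,
    pairing α X = pairing α Y) : X = Y := by
  ext x
  have : T2Space (E x) := FiberBundle.t2Space F E x
  have : FiniteDimensional ℝ (E x) := VectorBundle.finiteDimensional ℝ F E x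
  refine sub_eq_zero.1 ((Module.forall_dual_apply_eq_zero_iff ℝ (X x - Y x)).1 fun f => ?_)
  let g : DualBundle E x := LinearMap.toContinuousLinearMap (E := E x) (F' := ℝ) f
  obtain ⟨α, hα⟩ := exists_section_eq (I := I) (F := F →L[ℝ] ℝ) (E := DualBundle E) x g
  have h1 : α x (X x) = α x (Y x) :=
    congrArg (fun u : C^∞⟮I, M; 𝓘(ℝ, ℝ), ℝ⟯ => u x) (h α)
  rw [hα] at h1
  change f (X x) = f (Y x) at h1
  rw [map_sub, h1, sub_self]

lemma app_sub (L : BundleHom I F E F E) (X Y : Cₛ^∞⟮I; F, E⟯) :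
    app L (X - Y) = app L X - app L Y := by
  ext x; exact (L x).map_sub _ _

lemma app_homPow_zero (N : BundleHom I F E F E) (X : Cₛ^∞⟮I; F, E⟯) :
    app (homPow N 0) X = X := rfl

lemma app_homPow_succ (N : BundleHom I F E F E) (k : ℕ) (X : Cₛ^∞⟮I; F, E⟯) :
    app (homPow N (k + 1)) X = app (homPow N k) (app N X) := by
  ext x; exact congrArg (fun L : E x →L[ℝ] E x => L (X x)) (pow_succ (N x) k)

lemma app_homPow_succ' (N : BundleHom I F E F E) (k : ℕ) (X : Cₛ^∞⟮I; F, E⟯) :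
    app (homPow N (k + 1)) X = app N (app (homPow N k) X) := by
  ext x; exact congrArg (fun L : E x →L[ℝ] E x => L (X x)) (pow_succ' (N x) k)

lemma transpose_homPow (N : BundleHom I F E F E) (k : ℕ) :
    transpose (homPow N k) = homPow (transpose N) k := by
  ext x : 1
  change ContinuousLinearMap.precomp (Bundle.Trivial M ℝ x) (N x ^ k) =
    (ContinuousLinearMap.precomp (Bundle.Trivial M ℝ x) (N x) :
      DualBundle E x →L[ℝ] DualBundle E x) ^ k
  induction k with
  | zero => rfl
  | succ k ih =>
    rw [pow_succ (ContinuousLinearMap.precomp (Bundle.Trivial M ℝ x) (N x) :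
      DualBundle E x →L[ℝ] DualBundle E x), ← ih, pow_succ']
    rfl

lemma homComp_homPow_comm {P : BundleHom I (F →L[ℝ] ℝ) (DualBundle E) F E}
    {N : BundleHom I F E F E} (h : homComp N P = homComp P (transpose N)) (k : ℕ) :
    homComp (homPow N k) P = homComp P (transpose (homPow N k)) := by
  have h1 : ∀ (x : M) (δ : DualBundle E x), N x (P x δ) = P x (δ.comp (N x)) := fun x δ =>
    congrArg (fun L : BundleHom I (F →L[ℝ] ℝ) (DualBundle E) F E => L x δ) h
  ext x δ
  change (N x ^ k) (P x δ) = P x (δ.comp (N x ^ k))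
  induction k generalizing δ with
  | zero => rfl
  | succ k ih =>
    have h3 : (N x ^ (k + 1)) (P x δ) = (N x ^ k) (N x (P x δ)) := by
      rw [pow_succ]; rfl
    rw [h3, h1, ih, pow_succ']
    rfl

namespace SkewAlgebroid

variable (A : SkewAlgebroid I F E)

lemma bracket_neg_left (X Y : Cₛ^∞⟮I; F, E⟯) : A.bracket (-X) Y = -A.bracket X Y :=
  map_neg (AddMonoidHom.mk' (A.bracket · Y) fun X Z => A.bracket_add_left X Z Y) X

lemma bracket_neg_right (X Y : Cₛ^∞⟮I; F, E⟯) : A.bracket X (-Y) = -A.bracket X Y :=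
  map_neg (AddMonoidHom.mk' (A.bracket X) (A.bracket_add_right X)) Y

/-! ### The twisted action of sections on functions -/

/-- The twisted action `X · f = ρ(X) f + ⟨φ, X⟩ f` of sections on functions, that is, the
`A`-connection on the trivial line bundle with connection form `φ`; it is flat when `A` is a Lie
algebroid and `φ` a cocycle. -/
def phiAct (φ : OneForm I F E) (X : Cₛ^∞⟮I; F, E⟯) (f : C^∞⟮I, M; 𝓘(ℝ, ℝ), ℝ⟯) :
    C^∞⟮I, M; 𝓘(ℝ, ℝ), ℝ⟯ :=
  act A.anchor X f + pairing φ X * f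

variable (φ : OneForm I F E)

@[simp] lemma phiAct_neg (X : Cₛ^∞⟮I; F, E⟯) (f : C^∞⟮I, M; 𝓘(ℝ, ℝ), ℝ⟯) :
    A.phiAct φ X (-f) = -A.phiAct φ X f := by
  simp [phiAct]; ring

@[simp] lemma phiAct_sub (X : Cₛ^∞⟮I; F, E⟯) (f g : C^∞⟮I, M; 𝓘(ℝ, ℝ), ℝ⟯) :
    A.phiAct φ X (f - g) = A.phiAct φ X f - A.phiAct φ X g := by
  simp [phiAct]; ring

lemma phiAct_neg_left (X : Cₛ^∞⟮I; F, E⟯) (f : C^∞⟮I, M; 𝓘(ℝ, ℝ), ℝ⟯) :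
    A.phiAct φ (-X) f = -A.phiAct φ X f :=
  map_neg (AddMonoidHom.mk' (A.phiAct φ · f) fun X Z => by simp [phiAct]; ring) X

variable {A φ} in
/-- The twisted action of a Jacobi algebroid is flat. -/
lemma phiAct_bracket (hA : A.IsLieAlgebroid) (hφ : A.IsCocycle φ) (X Y : Cₛ^∞⟮I; F, E⟯)
    (f : C^∞⟮I, M; 𝓘(ℝ, ℝ), ℝ⟯) :
    A.phiAct φ (A.bracket X Y) f =
      A.phiAct φ X (A.phiAct φ Y f) - A.phiAct φ Y (A.phiAct φ X f) := by
  have h1 := hA.anchor_bracket X Y f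
  have h2 := hφ X Y
  simp only [dForm] at h2
  simp only [phiAct, act_add_right, act_mul_right]
  linear_combination h1 - f * h2

/-- In the bracket on 1-forms the cocycle enters only through the twisted action. -/
lemma pairing_dualBracket_phiAct (P : BundleHom I (F →L[ℝ] ℝ) (DualBundle E) F E)
    (α β : OneForm I F E) (Y : Cₛ^∞⟮I; F, E⟯) :
    pairing (A.dualBracket φ P α β) Y =
      A.phiAct φ (app P α) (pairing β Y) - pairing β (A.bracket (app P α) Y) -
      (A.phiAct φ (app P β) (pairing α Y) - pairing α (A.bracket (app P β) Y)) -
      A.phiAct φ Y (pairing β (app P α)) := by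
  simp [pairing_dualBracket, phiDForm, phiDFun, dForm, dFun, phiAct]
  ring

/-- The structure `(A_N, N* φ)` has twisted action `(X, f) ↦ (N X) · f`. -/
lemma phiAct_deform (N : BundleHom I F E F E) (X : Cₛ^∞⟮I; F, E⟯)
    (f : C^∞⟮I, M; 𝓘(ℝ, ℝ), ℝ⟯) :
    (A.deform N).phiAct (app (transpose N) φ) X f = A.phiAct φ (app N X) f := rfl

/-! ### Jacobi bivectors -/

/-- The Schouten-Jacobi square of `P` measures the failure of `P♯` to preserve brackets. -/
lemma schoutenJacobi_self (P : Bivector I F E) (α β γ : OneForm I F E) :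
    A.schoutenJacobi φ P P α β γ =
      2 * pairing γ (A.bracket (app P.sharp α) (app P.sharp β) -
        app P.sharp (A.dualBracket φ P.sharp α β)) := by
  have s := P.eval_skew
  have hb : pairing β (A.bracket (app P.sharp γ) (app P.sharp α)) =
      -pairing β (A.bracket (app P.sharp α) (app P.sharp γ)) := by
    rw [A.bracket_skew, pairing_neg_right]
  rw [pairing_sub_right, s (A.dualBracket φ P.sharp α β) γ,
    pairing_dualBracket_phiAct]
  simp only [schoutenJacobi, schouten, Bivector.wedge, Bivector.interior, Bivector.eval, phiAct,
    s φ, s β γ, hb, act_neg_right]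
  ring

variable {A φ}

/-- A bivector `P` is Jacobi exactly when `P♯` is a morphism of brackets from `A*_P` to `A`. -/
lemma isJacobiBivector_iff (P : Bivector I F E) : A.IsJacobiBivector φ P ↔
    ∀ α β, app P.sharp (A.dualBracket φ P.sharp α β) =
      A.bracket (app P.sharp α) (app P.sharp β) := by
  constructor
  · intro h α β
    refine section_ext_of_pairing fun γ => ?_
    have h1 := h α β γ
    rw [schoutenJacobi_self, two_mul, pairing_sub_right] at h1
    ext x
    have h2 := congrArg (fun u : C^∞⟮I, M; 𝓘(ℝ, ℝ), ℝ⟯ => u x) h1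
    change (pairing γ _ x - pairing γ _ x) + (pairing γ _ x - pairing γ _ x) = (0 : ℝ) at h2
    linarith
  · intro h α β γ
    rw [schoutenJacobi_self, h, pairing_sub_right, sub_self, mul_zero]

/-- The dual of a Jacobi algebroid along a Jacobi bivector is a Lie algebroid. -/
lemma IsJacobiBivector.isLieAlgebroid_dual {P : Bivector I F E} (hA : A.IsLieAlgebroid)
    (hφ : A.IsCocycle φ) (hP : A.IsJacobiBivector φ P) : (A.dual φ P).IsLieAlgebroid := by
  have hm := (isJacobiBivector_iff P).1 hP
  refine ⟨fun α β γ => oneForm_ext fun Y => ?_, fun α β f => ?_⟩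
  · change pairing (A.dualBracket φ P.sharp α (A.dualBracket φ P.sharp β γ) +
      A.dualBracket φ P.sharp β (A.dualBracket φ P.sharp γ α) +
      A.dualBracket φ P.sharp γ (A.dualBracket φ P.sharp α β)) Y = 0
    have s := P.eval_skew
    have hJ := congrArg (pairing γ) (hm α β)
    rw [s _ γ, pairing_dualBracket_phiAct] at hJ
    have hJY := congrArg (A.phiAct φ Y) hJ
    have hL : ∀ (η : OneForm I F E) (U V W : Cₛ^∞⟮I; F, E⟯),
        pairing η (A.bracket (A.bracket U V) W) =
          pairing η (A.bracket U (A.bracket V W)) - pairing η (A.bracket V (A.bracket U W)) := by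
      intro η U V W
      have h := congrArg (pairing η) (hA.jacobi U V W)
      have h0 : pairing η (0 : Cₛ^∞⟮I; F, E⟯) = 0 := by
        ext x; exact (η x).map_zero
      rw [pairing_add_right, pairing_add_right, h0, A.bracket_skew W U, A.bracket_skew W,
        A.bracket_neg_right, pairing_neg_right, pairing_neg_right] at h
      linear_combination -h
    have hba := A.bracket_skew (app P.sharp β) (app P.sharp α)
    have hca := A.bracket_skew (app P.sharp γ) (app P.sharp α)
    have hcb := A.bracket_skew (app P.sharp γ) (app P.sharp β)
    simp only [pairing_add_left, pairing_dualBracket_phiAct, hm, phiAct_sub, phiAct_neg,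
      phiAct_bracket hA hφ, hL, s β α, s γ α, s γ β, hba, hca, hcb, pairing_neg_right,
      A.bracket_neg_left, phiAct_neg_left] at hJY ⊢
    -- The Lie derivative terms cancel by the Jacobi identity of `A` and the flatness of the twisted
    -- action. What is left is exact: the differential, evaluated on `Y`, of twice the Jacobi
    -- condition on `α, β, γ`.
    linear_combination 2 * hJY
  · change act A.anchor (app P.sharp (A.dualBracket φ P.sharp α β)) f = _
    rw [hm]
    exact hA.anchor_bracket _ _ f

/-! ### Powers of a Nijenhuis operator -/

/-- The Nijenhuis condition says that `N` commutes with passing from `X` to the endomorphism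
`[X, N ·] - N [X, ·]`; this persists for powers of `N`. -/
lemma IsNijenhuis.bracket_homPow_homPow {N : BundleHom I F E F E} (h : A.IsNijenhuis N) (j k : ℕ)
    (X Y : Cₛ^∞⟮I; F, E⟯) :
    A.bracket (app (homPow N j) X) (app (homPow N k) Y) -
        app (homPow N k) (A.bracket (app (homPow N j) X) Y) =
      app (homPow N j) (A.bracket X (app (homPow N k) Y) - app (homPow N k) (A.bracket X Y)) := by
  have h1 : ∀ (j : ℕ) (X Y : Cₛ^∞⟮I; F, E⟯),
      A.bracket (app (homPow N j) X) (app N Y) =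
        app N (A.bracket (app (homPow N j) X) Y) +
          app (homPow N j) (A.bracket X (app N Y) - app N (A.bracket X Y)) := by
    intro j
    induction j with
    | zero => intro X Y; simp only [app_homPow_zero]; abel
    | succ j ih =>
      intro X Y
      have h2 := sub_eq_zero.1 (h (app (homPow N j) X) Y)
      rw [app_homPow_succ', app_homPow_succ', h2, deformedBracket, ih]
      simp only [app_add, app_sub]
      abel
  induction k generalizing Y with
  | zero =>
    simp only [app_homPow_zero, sub_self]
    ext x
    exact (JNAlgebroid.homPow N j x).map_zero.symm
  | succ k ih =>
    have h2 := ih (app N Y)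
    rw [h1 j X Y] at h2
    have hc : ∀ Z, app (homPow N j) (app (homPow N k) Z) = app (homPow N k) (app (homPow N j) Z) :=
      fun Z => by
        ext x
        exact congrArg (fun L : E x →L[ℝ] E x => L (Z x)) (((Commute.refl (N x)).pow_pow j k).eq)
    simp only [app_homPow_succ, app_add, app_sub, hc] at h2 ⊢
    rw [sub_eq_iff_eq_add] at h2 ⊢
    rw [h2]
    abel

lemma IsNijenhuis.homPow {N : BundleHom I F E F E} (h : A.IsNijenhuis N) (k : ℕ) :
    A.IsNijenhuis (homPow N k) := by
  intro X Y
  have := h.bracket_homPow_homPow k k X Y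
  rw [sub_eq_iff_eq_add] at this
  rw [this, deformedBracket]
  simp only [app_add, app_sub]
  abel

/-! ### Jacobi-Nijenhuis structures -/

/-- The difference of the two brackets required to agree in a Jacobi-Nijenhuis structure, written
with the twisted action. -/
lemma pairing_dualBracket_deform {P : BundleHom I (F →L[ℝ] ℝ) (DualBundle E) F E}
    {N : BundleHom I F E F E} (α β : OneForm I F E) (Y : Cₛ^∞⟮I; F, E⟯) :
    pairing (A.dualBracket φ (homComp N P) α β) Y -
        pairing ((A.deform N).dualBracket (app (transpose N) φ) P α β) Y =
      A.phiAct φ (app N Y) (pairing β (app P α)) - A.phiAct φ Y (pairing β (app N (app P α))) +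
        pairing β (A.bracket (app P α) (app N Y) - app N (A.bracket (app P α) Y)) -
        pairing α (A.bracket (app P β) (app N Y) - app N (A.bracket (app P β) Y)) := by
  have hc : ∀ γ, app (homComp N P) γ = app N (app P γ) := fun _ => rfl
  have hd : ∀ X Y, (A.deform N).bracket X Y = A.bracket (app N X) Y + A.bracket X (app N Y) -
    app N (A.bracket X Y) := fun _ _ => rfl
  rw [pairing_dualBracket_phiAct, pairing_dualBracket_phiAct]
  simp only [phiAct_deform, hc, hd, pairing_add_right, pairing_sub_right]
  ring

/-- The bracket condition in the definition of a Jacobi-Nijenhuis structure, evaluated on sections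
and written with the twisted action; see `isCompatible_iff`. In this form the powers of `N` can
be treated by induction. -/
def IsCompatible (A : SkewAlgebroid I F E) (φ : OneForm I F E)
    (P : BundleHom I (F →L[ℝ] ℝ) (DualBundle E) F E) (N : BundleHom I F E F E) : Prop :=
  ∀ (α β : OneForm I F E) (Y : Cₛ^∞⟮I; F, E⟯),
    A.phiAct φ (app N Y) (pairing β (app P α)) - A.phiAct φ Y (pairing β (app N (app P α))) +
      pairing β (A.bracket (app P α) (app N Y) - app N (A.bracket (app P α) Y)) -
      pairing α (A.bracket (app P β) (app N Y) - app N (A.bracket (app P β) Y)) = 0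

lemma isCompatible_iff {P : BundleHom I (F →L[ℝ] ℝ) (DualBundle E) F E}
    {N : BundleHom I F E F E} : A.IsCompatible φ P N ↔
      ∀ α β, A.dualBracket φ (homComp N P) α β =
        (A.deform N).dualBracket (app (transpose N) φ) P α β := by
  simp only [IsCompatible, ← pairing_dualBracket_deform, sub_eq_zero]
  exact ⟨fun h α β => oneForm_ext (h α β), fun h α β Y => by rw [h]⟩

/-- If `P` is compatible with the Nijenhuis operator `N`, it is compatible with its powers: the
condition for `N ^ (k + 1)` on `α, β, Y` is the sum of the one for `N` on `α, N* ^ k β, Y` and the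
one for `N ^ k` on `α, β, N Y`. -/
lemma IsCompatible.homPow {P : BundleHom I (F →L[ℝ] ℝ) (DualBundle E) F E}
    {N : BundleHom I F E F E} (h : A.IsCompatible φ P N) (hN : A.IsNijenhuis N)
    (hc : homComp N P = homComp P (transpose N)) (k : ℕ) :
    A.IsCompatible φ P (homPow N k) := by
  induction k with
  | zero => intro α β Y; simp only [app_homPow_zero, pairing_sub_right]; ring
  | succ k ih =>
    intro α β Y
    have hP : app P (app (transpose (JNAlgebroid.homPow N k)) β) =
        app (JNAlgebroid.homPow N k) (app P β) :=
      congrArg (fun L : BundleHom I (F →L[ℝ] ℝ) (DualBundle E) F E => app L β)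
        (homComp_homPow_comm hc k).symm
    have h1 := h α (app (transpose (JNAlgebroid.homPow N k)) β) Y
    have h2 := ih α β (app N Y)
    have h3 := congrArg (pairing α) (hN.bracket_homPow_homPow k 1 (app P β) Y)
    simp only [app_homPow_succ, app_homPow_zero] at h3
    simp only [hP, pairing_transpose, app_sub, pairing_sub_right, app_homPow_succ] at h1 h2 h3 ⊢
    linear_combination h1 + h2 + h3

/-- Jacobi-Nijenhuis structures are stable under replacing `N` by its powers. -/
lemma IsJacobiNijenhuis.homPow {P : Bivector I F E} {N : BundleHom I F E F E}
    (h : A.IsJacobiNijenhuis φ P N) (k : ℕ) : A.IsJacobiNijenhuis φ P (homPow N k) where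
  isLie := h.isLie
  cocycle := h.cocycle
  jacobi := h.jacobi
  nijenhuis := h.nijenhuis.homPow k
  comm := homComp_homPow_comm h.comm k
  bracket_eq := isCompatible_iff.1 ((isCompatible_iff.2 h.bracket_eq).homPow h.nijenhuis h.comm k)

namespace IsJacobiNijenhuis

variable {P : Bivector I F E} {N : BundleHom I F E F E}

lemma app_app_transpose (h : A.IsJacobiNijenhuis φ P N) (α : OneForm I F E) :
    app P.sharp (app (transpose N) α) = app N (app P.sharp α) :=
  congrArg (fun L : BundleHom I (F →L[ℝ] ℝ) (DualBundle E) F E => app L α) h.comm.symm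

/-- The bracket of `N P` is the deformation along `N*` of the bracket of `P`: the deformed bracket
and the bracket of `P` on `(A_N, N* φ)` always add up to twice the bracket of `N P`. -/
lemma dualBracket_homComp (h : A.IsJacobiNijenhuis φ P N) (α β : OneForm I F E) :
    A.dualBracket φ (homComp N P.sharp) α β =
      (A.dual φ P).deformedBracket (transpose N) α β := by
  have hc := isCompatible_iff.2 h.bracket_eq
  refine oneForm_ext fun Y => ?_
  have h1 := hc α β Y
  have hd : ∀ γ δ, (A.dual φ P).bracket γ δ = A.dualBracket φ P.sharp γ δ := fun _ _ => rfl
  have he : ∀ γ, app (homComp N P.sharp) γ = app N (app P.sharp γ) := fun _ => rfl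
  simp only [deformedBracket, hd, pairing_add_left, pairing_sub_left, pairing_transpose,
    pairing_sub_right, pairing_dualBracket_phiAct, h.app_app_transpose, he] at h1 ⊢
  linear_combination -h1

/-- The bivector `N P` is Jacobi: since `N` is Nijenhuis, `N P♯` sends the deformed bracket, which is
the bracket of `N P`, to the bracket of `A`. -/
lemma isJacobiBivector (h : A.IsJacobiNijenhuis φ P N) {Q : Bivector I F E}
    (hQ : Q.sharp = homComp N P.sharp) : A.IsJacobiBivector φ Q := by
  rw [isJacobiBivector_iff, hQ]
  intro α β
  have hP := (isJacobiBivector_iff P).1 h.jacobi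
  have he : ∀ γ, app (homComp N P.sharp) γ = app N (app P.sharp γ) := fun _ => rfl
  have hd : ∀ γ δ, (A.dual φ P).bracket γ δ = A.dualBracket φ P.sharp γ δ := fun _ _ => rfl
  have hs : ∀ γ δ : OneForm I F E, app P.sharp (γ - δ) = app P.sharp γ - app P.sharp δ :=
    fun γ δ => by ext x; exact (P.sharp x).map_sub _ _
  rw [h.dualBracket_homComp, he, he, he, sub_eq_zero.1 (h.nijenhuis _ _)]
  simp only [deformedBracket, hd, app_add, hs, hP, h.app_app_transpose]

/-- Given that the deformed bracket is the bracket of `N P`, the torsion of `N*` on `A*_P` at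
`α, β` is the compatibility condition at `α, N* β`. -/
lemma isNijenhuis_transpose (h : A.IsJacobiNijenhuis φ P N) :
    (A.dual φ P).IsNijenhuis (transpose N) := by
  intro α β
  rw [← h.dualBracket_homComp, sub_eq_zero]
  refine oneForm_ext fun Y => ?_
  have hc := isCompatible_iff.2 h.bracket_eq α (app (transpose N) β) Y
  have hd : ∀ γ δ, (A.dual φ P).bracket γ δ = A.dualBracket φ P.sharp γ δ := fun _ _ => rfl
  have he : ∀ γ, app (homComp N P.sharp) γ = app N (app P.sharp γ) := fun _ => rfl
  have h1 := congrArg (pairing β) (sub_eq_zero.1 (h.nijenhuis (app P.sharp α) Y))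
  simp only [deformedBracket, hd, app_add, app_sub, pairing_add_right, pairing_transpose,
    pairing_sub_right, pairing_dualBracket_phiAct, h.app_app_transpose, he] at hc h1 ⊢
  linear_combination hc + h1

end IsJacobiNijenhuis

end SkewAlgebroid
end TwistedAction
end JNAlgebroid
end
theorem mainTheorem7
    {EM : Type*} [NormedAddCommGroup EM] [NormedSpace ℝ EM] [FiniteDimensional ℝ EM]
    {H : Type*} [TopologicalSpace H] (I : ModelWithCorners ℝ EM H)
    {M : Type*} [TopologicalSpace M] [T2Space M] [ChartedSpace H M] [IsManifold I ∞ M]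
    (F : Type*) [NormedAddCommGroup F] [NormedSpace ℝ F] [FiniteDimensional ℝ F]
    (E : M → Type*) [∀ x, AddCommGroup (E x)] [∀ x, Module ℝ (E x)]
    [∀ x, TopologicalSpace (E x)] [∀ x, IsTopologicalAddGroup (E x)]
    [∀ x, ContinuousSMul ℝ (E x)] [TopologicalSpace (TotalSpace F E)]
    [FiberBundle F E] [VectorBundle ℝ F E] [ContMDiffVectorBundle ∞ F E I]
    (A : JNAlgebroid.SkewAlgebroid I F E) (φ₀ : JNAlgebroid.OneForm I F E)
    (P : JNAlgebroid.Bivector I F E) (N : JNAlgebroid.BundleHom I F E F E)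
    (h : A.IsJacobiNijenhuis φ₀ P N) (k : ℕ) :
    (A.dual φ₀ P).IsLieAlgebroid ∧
    (A.dual φ₀ P).IsNijenhuis (JNAlgebroid.homPow (JNAlgebroid.transpose N) k) ∧
    A.IsJacobiBivector φ₀ (P.powComp N h.comm k) ∧
    (A.dual φ₀ (P.powComp N h.comm k)).IsLieAlgebroid ∧
    A.dual φ₀ (P.powComp N h.comm k) =
      (A.dual φ₀ P).deform (JNAlgebroid.homPow (JNAlgebroid.transpose N) k) := by
  have hk := h.homPow k
  have hJ : A.IsJacobiBivector φ₀ (P.powComp N h.comm k) := hk.isJacobiBivector rfl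
  rw [← JNAlgebroid.transpose_homPow]
  refine ⟨h.jacobi.isLieAlgebroid_dual h.isLie h.cocycle, hk.isNijenhuis_transpose, hJ,
    hJ.isLieAlgebroid_dual h.isLie h.cocycle, ?_⟩
  refine JNAlgebroid.SkewAlgebroid.ext ?_ ?_
  · exact funext fun α => funext fun β => hk.dualBracket_homComp α β
  · exact congrArg (JNAlgebroid.homComp A.anchor) hk.comm
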